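/- Let $\Omega,U\subset\mathbb{R}^n$ be bounded open sets and let $\xi:\Omega\to U=\xi(\Omega)$ be a bilipschitz map with $\xi\in W^{2,2}(\Omega,\mathbb{R}^n)$. Let $G,\tilde G$ be two metrics on $\Omega$, i.e. fields of symmetric $n\times n$ matrices that are uniformly positive definite and locally Lipschitz with bounded first derivatives on $\Omega$ (for instance, metrics that are smooth up to the boundary). Suppose that $$(\nabla\xi)^T\,G\,\nabla\xi=\tilde G\qquad\text{a.e. in }\Omega .$$ For a metric $H=[H_{ij}]$ with inverse $[H^{ij}]$, the Christoffel symbols are $\frac12 H^{im}(\partial_l H_{mk}+\partial_k H_{ml}-\partial_m H_{kl})$ (upper index $i$, lower indices $k,l$; defined almost everywhere; repeated indices are summed from $1$ to $n$). Denote by $\tilde\Gamma^k_{ij}$ the Christoffel symbols of $\tilde G$ on $\Omega$ and by $\Gamma^k_{ij}$ those of the metric $G\circ\xi^{-1}$ on $U$. Then for all $i,j,s\in\{1,\dots,n\}$, $$\partial_{ij}\xi^s=\partial_m\xi^s\,\tilde\Gamma^m_{ij}-\partial_i\xi^p\,\partial_j\xi^q\,(\Gamma^s_{pq}\circ\xi)\qquad\text{a.e.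 in }\Omega ,$$ where derivatives of $\xi$ are weak derivatives. In particular, $\xi\in W^{2,\infty}(\Omega,\mathbb{R}^n)$. -/

import Mathlib

open MeasureTheory Set Topology
open scoped ContDiff ENNReal NNReal Matrix

/-- `g` is the weak (distributional) partial derivative `∂_i f` on the open set `Ω`. -/
def IsWeakPartial {n : ℕ} (Ω : Set (EuclideanSpace ℝ (Fin n))) (i : Fin n)
    (f g : EuclideanSpace ℝ (Fin n) → ℝ) : Prop :=
  LocallyIntegrableOn f Ω volume ∧ LocallyIntegrableOn g Ω volume ∧
    ∀ φ : EuclideanSpace ℝ (Fin n) → ℝ, ContDiff ℝ ∞ φ → HasCompactSupport φ → tsupport φ ⊆ Ω →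
      ∫ x in Ω, f x * fderiv ℝ φ x (EuclideanSpace.single i 1) = -∫ x in Ω, g x * φ x

/-- Weak partial derivatives are unique up to null sets. -/
theorem IsWeakPartial.ae_eq {n : ℕ} {Ω : Set (EuclideanSpace ℝ (Fin n))} (hΩ : IsOpen Ω)
    {i : Fin n} {f g g' : EuclideanSpace ℝ (Fin n) → ℝ}
    (h : IsWeakPartial Ω i f g) (h' : IsWeakPartial Ω i f g') :
    g =ᵐ[volume.restrict Ω] g' := by
  have key := hΩ.ae_eq_zero_of_integral_contDiff_smul_eq_zero (μ := volume)
    (f := fun x => g x - g' x) (h.2.1.sub h'.2.1) ?_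
  · rw [Filter.EventuallyEq, ae_restrict_iff' hΩ.measurableSet]
    filter_upwards [key] with x hx hxΩ
    exact sub_eq_zero.mp (hx hxΩ)
  · intro φ hφ hc hs
    have int : ∀ u : EuclideanSpace ℝ (Fin n) → ℝ, LocallyIntegrableOn u Ω volume →
        IntegrableOn (fun x => u x * φ x) Ω volume := by
      intro u hu
      have h1 : IntegrableOn (fun x => u x * φ x) (tsupport φ) volume :=
        (hu.integrableOn_compact_subset hs hc).mul_continuousOn hφ.continuous.continuousOn hc
      have h2 : Integrable (fun x => u x * φ x) volume :=
        (integrableOn_iff_integrable_of_support_subset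
          (fun x hx => subset_tsupport φ (fun h0 => hx (by simp [h0])))).1 h1
      exact h2.integrableOn
    have e1 := h.2.2 φ hφ hc hs
    have e2 := h'.2.2 φ hφ hc hs
    have e3 : ∫ x in Ω, (g x * φ x - g' x * φ x) = 0 := by
      rw [integral_sub (int g h.2.1) (int g' h'.2.1)]
      linarith
    rw [← e3, setIntegral_eq_integral_of_forall_compl_eq_zero]
    · refine integral_congr_ae (Filter.Eventually.of_forall fun x => ?_)
      simp only [smul_eq_mul]
      ring
    · intro x hx
      have : φ x = 0 := image_eq_zero_of_notMem_tsupport fun hh => hx (hs hh)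
      simp [this]

open Classical in
/-- The weak partial derivative `∂_i f` on `Ω` (a representative of its a.e.-class; `0` if there is
no weak derivative). -/
noncomputable def weakPartial {n : ℕ} (Ω : Set (EuclideanSpace ℝ (Fin n))) (i : Fin n)
    (f : EuclideanSpace ℝ (Fin n) → ℝ) : EuclideanSpace ℝ (Fin n) → ℝ :=
  if h : ∃ g, IsWeakPartial Ω i f g then h.choose else 0

/-- The Sobolev space `W^{k,p}(Ω)` of scalar functions. -/
def MemSobolev {n : ℕ} (Ω : Set (EuclideanSpace ℝ (Fin n))) (p : ℝ≥0∞) :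
    ℕ → (EuclideanSpace ℝ (Fin n) → ℝ) → Prop
  | 0, f => MemLp f p (volume.restrict Ω)
  | k + 1, f => MemLp f p (volume.restrict Ω) ∧
      ∀ i, ∃ g, IsWeakPartial Ω i f g ∧ MemSobolev Ω p k g

/-- The Sobolev space `W^{k,p}(Ω, ℝⁿ)` of vector fields. -/
def MemSobolevVec {n : ℕ} (Ω : Set (EuclideanSpace ℝ (Fin n))) (k : ℕ) (p : ℝ≥0∞)
    (ξ : EuclideanSpace ℝ (Fin n) → EuclideanSpace ℝ (Fin n)) : Prop :=
  ∀ s, MemSobolev Ω p k (fun x => ξ x s)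

/-- The weak gradient `∇ξ` on `Ω`, the matrix with entries `(∇ξ)_{sj} = ∂_j ξ^s`. -/
noncomputable def weakGradient {n : ℕ} (Ω : Set (EuclideanSpace ℝ (Fin n)))
    (ξ : EuclideanSpace ℝ (Fin n) → EuclideanSpace ℝ (Fin n)) (x : EuclideanSpace ℝ (Fin n)) :
    Matrix (Fin n) (Fin n) ℝ :=
  Matrix.of fun s j => weakPartial Ω j (fun y => ξ y s) x

/-- The map `ξ` is bilipschitz on `Ω` (and so a bilipschitz map of `Ω` onto its image). -/
def BilipschitzOn {n : ℕ} (Ω : Set (EuclideanSpace ℝ (Fin n)))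
    (ξ : EuclideanSpace ℝ (Fin n) → EuclideanSpace ℝ (Fin n)) : Prop :=
  ∃ K : ℝ, 0 < K ∧ ∀ x ∈ Ω, ∀ y ∈ Ω,
    dist (ξ x) (ξ y) ≤ K * dist x y ∧ dist x y ≤ K * dist (ξ x) (ξ y)

/-- The classical partial derivative `∂_k f`. It exists almost everywhere in the domain of a locally
Lipschitz function (Rademacher), and agrees there with the weak one. -/
noncomputable def partialDeriv {n : ℕ} (k : Fin n) (f : EuclideanSpace ℝ (Fin n) → ℝ)
    (x : EuclideanSpace ℝ (Fin n)) : ℝ :=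
  fderiv ℝ f x (EuclideanSpace.single k 1)

/-- A Riemannian metric on the open set `Ω` in Cartesian coordinates: a field of symmetric,
uniformly positive definite matrices, locally Lipschitz with bounded first derivatives. Metrics that
are Lipschitz on `Ω`, and metrics that are smooth up to the boundary, are of this kind. -/
structure IsMetricOn {n : ℕ} (Ω : Set (EuclideanSpace ℝ (Fin n)))
    (G : EuclideanSpace ℝ (Fin n) → Matrix (Fin n) (Fin n) ℝ) : Prop where
  symm : ∀ x ∈ Ω, (G x).IsSymm
  unif_pos : ∃ c : ℝ, 0 < c ∧ ∀ x ∈ Ω, ∀ v : Fin n → ℝ, c * (v ⬝ᵥ v) ≤ v ⬝ᵥ (G x *ᵥ v)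
  locLip : ∀ i j, LocallyLipschitzOn Ω fun x => G x i j
  deriv_bdd : ∃ C : ℝ, ∀ x ∈ Ω, ∀ i j k, |partialDeriv k (fun y => G y i j) x| ≤ C

/-- The Christoffel symbols of the second kind
`Γ^i_{kl} = ½ G^{im} (∂_l G_{mk} + ∂_k G_{ml} - ∂_m G_{kl})`. -/
noncomputable def christoffel {n : ℕ}
    (G : EuclideanSpace ℝ (Fin n) → Matrix (Fin n) (Fin n) ℝ) (i k l : Fin n)
    (x : EuclideanSpace ℝ (Fin n)) : ℝ :=
  1 / 2 * ∑ m, (G x)⁻¹ i m *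
    (partialDeriv l (fun y => G y m k) x + partialDeriv k (fun y => G y m l) x
      - partialDeriv m (fun y => G y k l) x)

/-- The metric `G ∘ ξ⁻¹` on `ξ(Ω)`, where `ξ⁻¹ : ξ(Ω) → Ω` is the inverse of the map `ξ`, injective
on `Ω`. -/
noncomputable def transportedMetric {n : ℕ} (Ω : Set (EuclideanSpace ℝ (Fin n)))
    (ξ : EuclideanSpace ℝ (Fin n) → EuclideanSpace ℝ (Fin n))
    (G : EuclideanSpace ℝ (Fin n) → Matrix (Fin n) (Fin n) ℝ) :
    EuclideanSpace ℝ (Fin n) → Matrix (Fin n) (Fin n) ℝ :=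
  fun u => G (Function.invFunOn ξ Ω u)

/-! Write `F = ∇ξ` and `S_k = ∂_k F`. Differentiating `Fᵀ G F = G̃` gives `∂_k G̃ = S_kᵀ G F + Fᵀ
(∂_k G) F + Fᵀ G S_k`. Second weak derivatives commute, so the cyclic combination of these
identities that proves uniqueness of the Levi-Civita connection isolates `Fᵀ G S_i`. Since `(Fᵀ G)⁻¹
= F G̃⁻¹`, it can be solved for the Hessian of `ξ` (`hessian_eq_of_transpose_mul_mul`). The terms in
`∂G̃` become `F Γ̃`. In the terms in `∂G`, the chain rule for `G = (G ∘ ξ⁻¹) ∘ ξ` and `F G̃⁻¹ Fᵀ =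
G⁻¹` produce `Γ ∘ ξ` (`transpose_mul_mul_koszul`, `mul_inv_mul_transpose_eq_inv`). The solved
formula contains only bounded quantities, hence `W^{2,∞}`.

Two analytic points remain. The product rule is applied to weak derivatives: entries of `F` are
bounded with locally integrable derivatives, those of `G` are locally Lipschitz, and
`IsWeakPartial.mul` covers such factors by mollifying one of them. The chain rule needs `G ∘ ξ⁻¹` to
be differentiable at `ξ x` for almost every `x`: this is Rademacher's theorem on `ξ(Ω)`, pulled back
by a bilipschitz map, which preserves null sets. -/

/-! ### Mollification -/

/-- The mollification `ρ ⋆ u` of `u` by the normalized bump function `ρ`. -/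
noncomputable def mollify {n : ℕ} (ρ : ContDiffBump (0 : EuclideanSpace ℝ (Fin n)))
    (u : EuclideanSpace ℝ (Fin n) → ℝ) (x : EuclideanSpace ℝ (Fin n)) : ℝ :=
  ∫ y, ρ.normed volume (x - y) * u y

theorem mollify_eq_convolution {n : ℕ} (ρ : ContDiffBump (0 : EuclideanSpace ℝ (Fin n)))
    (u : EuclideanSpace ℝ (Fin n) → ℝ) :
    mollify ρ u = convolution (ρ.normed volume) u (ContinuousLinearMap.lsmul ℝ ℝ) volume := by
  funext x
  rw [convolution_eq_swap]
  rfl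

theorem contDiff_mollify {n : ℕ} (ρ : ContDiffBump (0 : EuclideanSpace ℝ (Fin n)))
    {u : EuclideanSpace ℝ (Fin n) → ℝ} (hu : LocallyIntegrable u volume) :
    ContDiff ℝ ∞ (mollify ρ u) := by
  rw [mollify_eq_convolution]
  exact ρ.hasCompactSupport_normed.contDiff_convolution_left _ ρ.contDiff_normed hu

/-- The kernel is nonnegative with integral one, so mollifying is averaging. The bound does not
depend on `ρ`, which makes it usable for domination. -/
theorem abs_mollify_le {n : ℕ} (ρ : ContDiffBump (0 : EuclideanSpace ℝ (Fin n)))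
    {u : EuclideanSpace ℝ (Fin n) → ℝ} {M : ℝ} (hM : ∀ᵐ x, |u x| ≤ M)
    (x : EuclideanSpace ℝ (Fin n)) : |mollify ρ u x| ≤ M := by
  have h1 : Integrable (fun y => ρ.normed volume (x - y)) volume :=
    ρ.integrable_normed.comp_sub_left x
  have h2 : ∫ y, ρ.normed volume (x - y) * M = M := by
    rw [integral_mul_const, integral_sub_left_eq_self (ρ.normed volume) volume x,
      ρ.integral_normed, one_mul]
  rw [← h2, ← Real.norm_eq_abs]
  refine norm_integral_le_of_norm_le (h1.mul_const M) ?_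
  filter_upwards [hM] with y hy
  rw [norm_mul, Real.norm_of_nonneg (ρ.nonneg_normed _)]
  exact mul_le_mul_of_nonneg_left hy (ρ.nonneg_normed _)

/-- Fubini and evenness of the kernel. -/
theorem integral_mollify_mul {n : ℕ} (ρ : ContDiffBump (0 : EuclideanSpace ℝ (Fin n)))
    {u w : EuclideanSpace ℝ (Fin n) → ℝ} (hu : Integrable u volume) (hw : Integrable w volume) :
    ∫ x, mollify ρ u x * w x = ∫ x, u x * mollify ρ w x := by
  simp only [mollify, ← integral_mul_const, ← integral_const_mul]
  rw [integral_integral_swap]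
  · refine integral_congr_ae (Filter.Eventually.of_forall fun y => integral_congr_ae
      (Filter.Eventually.of_forall fun x => ?_))
    simp only
    rw [← neg_sub y x, ρ.normed_neg]
    ring
  · have hc : Continuous fun p : EuclideanSpace ℝ (Fin n) × EuclideanSpace ℝ (Fin n) =>
        ρ.normed volume (p.1 - p.2) :=
      ρ.continuous_normed.comp (continuous_fst.sub continuous_snd)
    obtain ⟨C, hC⟩ := ρ.hasCompactSupport_normed (μ := volume)
      |>.exists_bound_of_continuous ρ.continuous_normed
    have := (hw.mul_prod hu).bdd_mul (c := C) hc.aestronglyMeasurable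
      (Filter.Eventually.of_forall fun p => hC _)
    refine this.congr (Filter.Eventually.of_forall fun p => ?_)
    simp only [Function.uncurry]
    ring

/-- Dominated convergence with majorant `M * ‖w‖`: only `u` has to be bounded, `w` is merely
integrable. The bounded ratio of the radii gives pointwise convergence almost everywhere. -/
theorem tendsto_integral_mollify_mul {n : ℕ}
    {ρ : ℕ → ContDiffBump (0 : EuclideanSpace ℝ (Fin n))}
    (hρ : Filter.Tendsto (fun k => (ρ k).rOut) Filter.atTop (𝓝 0))
    (hρ' : ∀ k, (ρ k).rOut ≤ 2 * (ρ k).rIn)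
    {u w : EuclideanSpace ℝ (Fin n) → ℝ} {M : ℝ} (hM : ∀ᵐ x, |u x| ≤ M)
    (hu : LocallyIntegrable u volume) (hw : Integrable w volume) :
    Filter.Tendsto (fun k => ∫ x, mollify (ρ k) u x * w x) Filter.atTop
      (𝓝 (∫ x, u x * w x)) := by
  refine tendsto_integral_of_dominated_convergence (fun x => M * ‖w x‖) (fun k => ?_)
    (hw.norm.const_mul M) (fun k => Filter.Eventually.of_forall fun x => ?_) ?_
  · exact (contDiff_mollify (ρ k) hu).continuous.aestronglyMeasurable.mul hw.aestronglyMeasurable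
  · rw [norm_mul]
    exact mul_le_mul_of_nonneg_right (abs_mollify_le (ρ k) hM x) (norm_nonneg _)
  · filter_upwards [ContDiffBump.ae_convolution_tendsto_right_of_locallyIntegrable hρ
      (Filter.Eventually.of_forall hρ') hu] with x hx
    simp only [mollify_eq_convolution]
    exact hx.mul_const _

/-! ### Test functions and weak derivatives -/

theorem integrable_mul_of_tsupport_subset {n : ℕ} {Ω : Set (EuclideanSpace ℝ (Fin n))}
    {u φ : EuclideanSpace ℝ (Fin n) → ℝ} (hu : LocallyIntegrableOn u Ω volume)
    (hφ : Continuous φ) (hc : HasCompactSupport φ) (hs : tsupport φ ⊆ Ω) :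
    Integrable (fun x => u x * φ x) volume :=
  (integrableOn_iff_integrable_of_support_subset
    (fun x hx => subset_tsupport φ (fun h0 => hx (by simp [h0])))).1
    ((hu.integrableOn_compact_subset hs hc).mul_continuousOn hφ.continuousOn hc)

theorem tsupport_fderiv_apply_const_subset {n : ℕ} (φ : EuclideanSpace ℝ (Fin n) → ℝ)
    (v : EuclideanSpace ℝ (Fin n)) : tsupport (fun x => fderiv ℝ φ x v) ⊆ tsupport φ :=
  closure_minimal (fun x hx => support_fderiv_subset ℝ (fun h0 => hx (by simp [h0])))
    (isClosed_tsupport φ)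

theorem hasCompactSupport_fderiv_apply_const {n : ℕ} {φ : EuclideanSpace ℝ (Fin n) → ℝ}
    (hc : HasCompactSupport φ) (v : EuclideanSpace ℝ (Fin n)) :
    HasCompactSupport (fun x => fderiv ℝ φ x v) :=
  hc.of_isClosed_subset (isClosed_tsupport _) (tsupport_fderiv_apply_const_subset φ v)

theorem setIntegral_mul_of_tsupport_subset {n : ℕ} {Ω : Set (EuclideanSpace ℝ (Fin n))}
    {u φ : EuclideanSpace ℝ (Fin n) → ℝ} (hs : tsupport φ ⊆ Ω) :
    ∫ x in Ω, u x * φ x = ∫ x, u x * φ x :=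
  setIntegral_eq_integral_of_forall_compl_eq_zero fun x hx => by
    rw [image_eq_zero_of_notMem_tsupport fun h => hx (hs h), mul_zero]

/-- The weak derivative commutes with mollification, away from the boundary. -/
theorem IsWeakPartial.fderiv_mollify {n : ℕ} {Ω K : Set (EuclideanSpace ℝ (Fin n))} {i : Fin n}
    {f g : EuclideanSpace ℝ (Fin n) → ℝ} (h : IsWeakPartial Ω i f g) (hK : IsCompact K)
    (hKΩ : K ⊆ Ω) (ρ : ContDiffBump (0 : EuclideanSpace ℝ (Fin n))) {x : EuclideanSpace ℝ (Fin n)}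
    (hx : Metric.closedBall x ρ.rOut ⊆ K) :
    fderiv ℝ (mollify ρ (K.indicator f)) x (EuclideanSpace.single i 1) =
      mollify ρ (K.indicator g) x := by
  have hint : ∀ u : EuclideanSpace ℝ (Fin n) → ℝ, LocallyIntegrableOn u Ω volume →
      Integrable (K.indicator u) volume := fun u hu =>
    (hu.integrableOn_compact_subset hKΩ hK).integrable_indicator hK.measurableSet
  -- The kernel centred at `x` is itself the test function. Its support lies in `K`, so truncation
  -- to `K` is invisible, and the sign from differentiating in `y` instead of `x` cancels the sign
  -- in the definition of the weak derivative.
  set ψ : EuclideanSpace ℝ (Fin n) → ℝ := fun y => ρ.normed volume (x - y) with hψ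
  have hψs : ContDiff ℝ ∞ ψ := ρ.contDiff_normed.comp (contDiff_const.sub contDiff_id)
  have hψt : tsupport ψ ⊆ Metric.closedBall x ρ.rOut := by
    refine closure_minimal (fun y hy => ?_) Metric.isClosed_closedBall
    have : x - y ∈ Function.support (ρ.normed volume) := hy
    rw [ρ.support_normed_eq, mem_ball_zero_iff, ← dist_eq_norm] at this
    rw [Metric.mem_closedBall, dist_comm]
    exact this.le
  have hψc : HasCompactSupport ψ :=
    (isCompact_closedBall x ρ.rOut).of_isClosed_subset (isClosed_tsupport _) hψt
  have hρd : Differentiable ℝ (ρ.normed volume) :=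
    (ρ.contDiff_normed (n := ⊤)).differentiable (by simp)
  have hψd : ∀ y, fderiv ℝ ψ y (EuclideanSpace.single i 1) =
      -fderiv ℝ (ρ.normed volume) (x - y) (EuclideanSpace.single i 1) := by
    intro y
    have h1 : HasFDerivAt ψ _ y :=
      (hρd (x - y)).hasFDerivAt.comp y ((hasFDerivAt_id y).const_sub x)
    rw [h1.fderiv]
    simp
  have key := h.2.2 ψ hψs hψc (hψt.trans (hx.trans hKΩ))
  rw [setIntegral_mul_of_tsupport_subset ((tsupport_fderiv_apply_const_subset ψ _).trans
      (hψt.trans (hx.trans hKΩ))),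
    setIntegral_mul_of_tsupport_subset (hψt.trans (hx.trans hKΩ))] at key
  have e1 := (ρ.hasCompactSupport_normed (μ := volume)).hasFDerivAt_convolution_left (μ := volume)
    (ContinuousLinearMap.lsmul ℝ ℝ) (ρ.contDiff_normed (n := 1)) (hint f h.1).locallyIntegrable x
  rw [mollify_eq_convolution ρ (K.indicator f), e1.fderiv, convolution_eq_swap,
    ContinuousLinearMap.integral_apply]
  · have e2 : ∀ y, ((ContinuousLinearMap.precompL (EuclideanSpace ℝ (Fin n))
        (ContinuousLinearMap.lsmul ℝ ℝ)) (fderiv ℝ (ρ.normed volume) (x - y))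
          (K.indicator f y)) (EuclideanSpace.single i 1) =
        -(f y * fderiv ℝ ψ y (EuclideanSpace.single i 1)) := by
      intro y
      rw [hψd]
      by_cases hy : y ∈ K
      · simp [hy, mul_comm, ContinuousLinearMap.precompL_apply]
      · have : fderiv ℝ ψ y (EuclideanSpace.single i 1) = 0 :=
          image_eq_zero_of_notMem_tsupport (f := fun z => fderiv ℝ ψ z (EuclideanSpace.single i 1))
            fun hh => hy (hx (hψt (tsupport_fderiv_apply_const_subset ψ _ hh)))
        rw [hψd] at this
        simp [hy, this]
    simp only [e2]
    rw [integral_neg, key, neg_neg, mollify]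
    refine integral_congr_ae (Filter.Eventually.of_forall fun y => ?_)
    by_cases hy : y ∈ K
    · simp [hy, hψ, mul_comm]
    · have : ψ y = 0 := image_eq_zero_of_notMem_tsupport fun hh => hy (hx (hψt hh))
      simp [hy, this]
  · have := (ρ.hasCompactSupport_normed (μ := volume)).fderiv (𝕜 := ℝ)
      |>.convolutionExists_left (ContinuousLinearMap.precompL (EuclideanSpace ℝ (Fin n))
      (ContinuousLinearMap.lsmul ℝ ℝ)) (μ := volume)
      ((ρ.contDiff_normed (n := ⊤)).continuous_fderiv (by simp))
      (hint f h.1).locallyIntegrable x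
    exact this.integrable_swap

/-! ### Calculus of weak derivatives -/

/-- `f` is essentially bounded on the compact subsets of `Ω`. -/
def LocallyEssBoundedOn {n : ℕ} (Ω : Set (EuclideanSpace ℝ (Fin n)))
    (f : EuclideanSpace ℝ (Fin n) → ℝ) : Prop :=
  ∀ K ⊆ Ω, IsCompact K → ∃ M, ∀ᵐ x ∂volume.restrict K, |f x| ≤ M

theorem LocallyEssBoundedOn.mul {n : ℕ} {Ω : Set (EuclideanSpace ℝ (Fin n))}
    {f g : EuclideanSpace ℝ (Fin n) → ℝ} (hf : LocallyEssBoundedOn Ω f)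
    (hg : LocallyEssBoundedOn Ω g) : LocallyEssBoundedOn Ω fun x => f x * g x := by
  intro K hK hc
  obtain ⟨M, hM⟩ := hf K hK hc
  obtain ⟨N, hN⟩ := hg K hK hc
  refine ⟨M * N, ?_⟩
  filter_upwards [hM, hN] with x h1 h2
  rw [abs_mul]
  exact mul_le_mul h1 h2 (abs_nonneg _) ((abs_nonneg _).trans h1)

theorem LocallyEssBoundedOn.of_continuousOn {n : ℕ} {Ω : Set (EuclideanSpace ℝ (Fin n))}
    {f : EuclideanSpace ℝ (Fin n) → ℝ} (hf : ContinuousOn f Ω) : LocallyEssBoundedOn Ω f := by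
  intro K hK hc
  obtain ⟨M, hM⟩ := hc.exists_bound_of_continuousOn (hf.mono hK)
  exact ⟨M, (ae_restrict_iff' hc.measurableSet).2 (Filter.Eventually.of_forall hM)⟩

theorem LocallyEssBoundedOn.of_ae_le {n : ℕ} {Ω : Set (EuclideanSpace ℝ (Fin n))}
    {f : EuclideanSpace ℝ (Fin n) → ℝ} {M : ℝ} (hf : ∀ᵐ x ∂volume.restrict Ω, |f x| ≤ M) :
    LocallyEssBoundedOn Ω f :=
  fun _ hK _ => ⟨M, ae_mono (Measure.restrict_mono hK le_rfl) hf⟩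

theorem locallyIntegrableOn_congr_ae {n : ℕ} {Ω : Set (EuclideanSpace ℝ (Fin n))}
    (hΩ : IsOpen Ω) {f g : EuclideanSpace ℝ (Fin n) → ℝ} (hf : LocallyIntegrableOn f Ω volume)
    (h : f =ᵐ[volume.restrict Ω] g) : LocallyIntegrableOn g Ω volume := by
  rw [locallyIntegrableOn_iff hΩ.isLocallyClosed] at hf ⊢
  exact fun K hK hc => (hf K hK hc).congr_fun_ae (ae_mono (Measure.restrict_mono hK le_rfl) h)

theorem LocallyEssBoundedOn.mul_locallyIntegrableOn {n : ℕ} {Ω : Set (EuclideanSpace ℝ (Fin n))}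
    (hΩ : IsOpen Ω) {f g : EuclideanSpace ℝ (Fin n) → ℝ} (hf : LocallyEssBoundedOn Ω f)
    (hf' : LocallyIntegrableOn f Ω volume) (hg : LocallyIntegrableOn g Ω volume) :
    LocallyIntegrableOn (fun x => f x * g x) Ω volume := by
  rw [locallyIntegrableOn_iff hΩ.isLocallyClosed] at hf' hg ⊢
  intro K hK hc
  obtain ⟨M, hM⟩ := hf K hK hc
  exact (hg K hK hc).bdd_mul (hf' K hK hc).aestronglyMeasurable hM

theorem IsWeakPartial.congr {n : ℕ} {Ω : Set (EuclideanSpace ℝ (Fin n))} (hΩ : IsOpen Ω)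
    {i : Fin n} {f f' g g' : EuclideanSpace ℝ (Fin n) → ℝ} (h : IsWeakPartial Ω i f g)
    (hf : f =ᵐ[volume.restrict Ω] f') (hg : g =ᵐ[volume.restrict Ω] g') :
    IsWeakPartial Ω i f' g' := by
  refine ⟨locallyIntegrableOn_congr_ae hΩ h.1 hf, locallyIntegrableOn_congr_ae hΩ h.2.1 hg,
    fun φ h1 h2 h3 => ?_⟩
  have e1 : ∫ x in Ω, f' x * fderiv ℝ φ x (EuclideanSpace.single i 1) =
      ∫ x in Ω, f x * fderiv ℝ φ x (EuclideanSpace.single i 1) :=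
    integral_congr_ae (by filter_upwards [hf] with x hx; rw [hx])
  have e2 : ∫ x in Ω, g' x * φ x = ∫ x in Ω, g x * φ x :=
    integral_congr_ae (by filter_upwards [hg] with x hx; rw [hx])
  rw [e1, e2, h.2.2 φ h1 h2 h3]

theorem integrable_mul_fderiv_of_tsupport_subset {n : ℕ} {Ω : Set (EuclideanSpace ℝ (Fin n))}
    {u φ : EuclideanSpace ℝ (Fin n) → ℝ} (hu : LocallyIntegrableOn u Ω volume)
    (hφ : ContDiff ℝ ∞ φ) (hc : HasCompactSupport φ) (hs : tsupport φ ⊆ Ω)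
    (v : EuclideanSpace ℝ (Fin n)) :
    Integrable (fun x => u x * fderiv ℝ φ x v) volume :=
  integrable_mul_of_tsupport_subset hu
    ((hφ.continuous_fderiv (by simp)).clm_apply continuous_const)
    (hasCompactSupport_fderiv_apply_const hc v)
    ((tsupport_fderiv_apply_const_subset φ v).trans hs)

theorem isWeakPartial_zero {n : ℕ} (Ω : Set (EuclideanSpace ℝ (Fin n))) (i : Fin n) :
    IsWeakPartial Ω i (fun _ => 0) fun _ => 0 :=
  ⟨locallyIntegrable_zero.locallyIntegrableOn Ω, locallyIntegrable_zero.locallyIntegrableOn Ω,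
    fun _ _ _ _ => by simp⟩

theorem IsWeakPartial.add {n : ℕ} {Ω : Set (EuclideanSpace ℝ (Fin n))} {i : Fin n}
    {f f' g g' : EuclideanSpace ℝ (Fin n) → ℝ} (h : IsWeakPartial Ω i f g)
    (h' : IsWeakPartial Ω i f' g') :
    IsWeakPartial Ω i (fun x => f x + f' x) fun x => g x + g' x := by
  refine ⟨h.1.add h'.1, h.2.1.add h'.2.1, fun φ h1 h2 h3 => ?_⟩
  simp only [add_mul]
  rw [integral_add (integrable_mul_fderiv_of_tsupport_subset h.1 h1 h2 h3 _).integrableOn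
      (integrable_mul_fderiv_of_tsupport_subset h'.1 h1 h2 h3 _).integrableOn,
    integral_add (integrable_mul_of_tsupport_subset h.2.1 h1.continuous h2 h3).integrableOn
      (integrable_mul_of_tsupport_subset h'.2.1 h1.continuous h2 h3).integrableOn,
    h.2.2 φ h1 h2 h3, h'.2.2 φ h1 h2 h3, neg_add]

theorem IsWeakPartial.sum {n : ℕ} {Ω : Set (EuclideanSpace ℝ (Fin n))} {i : Fin n} {ι : Type*}
    (s : Finset ι) {f g : ι → EuclideanSpace ℝ (Fin n) → ℝ}
    (h : ∀ a ∈ s, IsWeakPartial Ω i (f a) (g a)) :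
    IsWeakPartial Ω i (fun x => ∑ a ∈ s, f a x) fun x => ∑ a ∈ s, g a x := by
  classical
  induction s using Finset.induction_on with
  | empty => simpa using isWeakPartial_zero Ω i
  | insert a s ha ih =>
    simp only [Finset.sum_insert ha]
    exact (h a (by simp)).add (ih fun b hb => h b (by simp [hb]))

/-- Weak second partial derivatives commute. -/
theorem IsWeakPartial.ae_eq_of_swap {n : ℕ} {Ω : Set (EuclideanSpace ℝ (Fin n))} (hΩ : IsOpen Ω)
    {i j : Fin n} {f gi gj hij hji : EuclideanSpace ℝ (Fin n) → ℝ}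
    (hi : IsWeakPartial Ω i f gi) (hj : IsWeakPartial Ω j f gj)
    (h1 : IsWeakPartial Ω i gj hij) (h2 : IsWeakPartial Ω j gi hji) :
    hij =ᵐ[volume.restrict Ω] hji := by
  -- By uniqueness it suffices that `hji` is also a weak `∂_i` of `gj`. Both sides of that identity
  -- reduce to the integral of `f` against the second derivative of `φ`, which is symmetric.
  refine h1.ae_eq hΩ ⟨h1.1, h2.2.1, fun φ hφ hc hs => ?_⟩
  have hd : ∀ v : EuclideanSpace ℝ (Fin n), ContDiff ℝ ∞ fun x => fderiv ℝ φ x v := fun v =>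
    (hφ.fderiv_right (m := ∞) (by simp)).clm_apply contDiff_const
  have e1 := hj.2.2 _ (hd (EuclideanSpace.single i 1)) (hasCompactSupport_fderiv_apply_const hc _)
    ((tsupport_fderiv_apply_const_subset φ _).trans hs)
  have e2 := hi.2.2 _ (hd (EuclideanSpace.single j 1)) (hasCompactSupport_fderiv_apply_const hc _)
    ((tsupport_fderiv_apply_const_subset φ _).trans hs)
  have e3 := h2.2.2 φ hφ hc hs
  have hsymm : ∀ x v w, fderiv ℝ (fun y => fderiv ℝ φ y v) x w =
      fderiv ℝ (fun y => fderiv ℝ φ y w) x v := by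
    intro x v w
    have hd2 : DifferentiableAt ℝ (fderiv ℝ φ) x :=
      (hφ.fderiv_right (m := ∞) (by simp)).differentiable (by simp) x
    rw [fderiv_clm_apply hd2 (differentiableAt_const v),
      fderiv_clm_apply hd2 (differentiableAt_const w)]
    simpa using (hφ.contDiffAt (x := x)).isSymmSndFDerivAt
      (by simpa using WithTop.coe_le_coe.2 (le_top (a := (2 : ℕ∞)))) w v
  simp only [hsymm _ (EuclideanSpace.single i 1) (EuclideanSpace.single j 1)] at e1
  rw [e1, neg_inj] at e2
  rw [e2, e3]

theorem exists_seq_contDiffBump {n : ℕ} {δ : ℝ} (hδ : 0 < δ) :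
    ∃ ρ : ℕ → ContDiffBump (0 : EuclideanSpace ℝ (Fin n)),
      Filter.Tendsto (fun k => (ρ k).rOut) Filter.atTop (𝓝 0) ∧
      (∀ k, (ρ k).rOut ≤ 2 * (ρ k).rIn) ∧ ∀ k, (ρ k).rOut ≤ δ := by
  have h1 : ∀ k : ℕ, 0 < δ / ((k : ℝ) + 1) := fun k => by positivity
  refine ⟨fun k => ⟨δ / ((k : ℝ) + 1) / 2, δ / ((k : ℝ) + 1), half_pos (h1 k),
    half_lt_self (h1 k)⟩, ?_, fun k => ?_, fun k => ?_⟩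
  · simpa [div_eq_mul_inv] using
      (tendsto_one_div_add_atTop_nhds_zero_nat (𝕜 := ℝ)).const_mul δ
  · exact (mul_div_cancel₀ _ two_ne_zero).ge
  · exact div_le_self hδ.le (by simp)

/-- The Leibniz rule for weak derivatives of locally essentially bounded functions. -/
theorem IsWeakPartial.mul {n : ℕ} {Ω : Set (EuclideanSpace ℝ (Fin n))} (hΩ : IsOpen Ω)
    {i : Fin n} {f f' g g' : EuclideanSpace ℝ (Fin n) → ℝ} (hf : IsWeakPartial Ω i f f')
    (hg : IsWeakPartial Ω i g g') (hfb : LocallyEssBoundedOn Ω f)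
    (hgb : LocallyEssBoundedOn Ω g) :
    IsWeakPartial Ω i (fun x => f x * g x) fun x => f' x * g x + f x * g' x := by
  have l0 := hfb.mul_locallyIntegrableOn hΩ hf.1 hg.1
  have l1 : LocallyIntegrableOn (fun x => f' x * g x) Ω volume := by
    simpa only [mul_comm] using hgb.mul_locallyIntegrableOn hΩ hg.1 hf.2.1
  have l2 := hfb.mul_locallyIntegrableOn hΩ hf.1 hg.2.1
  refine ⟨l0, l1.add l2, fun φ hφ hc hs => ?_⟩
  -- Room for the kernels: balls of radius at most `δ` about points of the support of `φ` stay in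
  -- the compact set `K ⊆ Ω`.
  obtain ⟨δ, hδ, hδΩ⟩ := hc.exists_cthickening_subset_open hΩ hs
  set K := Metric.cthickening δ (tsupport φ) with hK
  have hKc : IsCompact K := hc.cthickening
  have hsK : tsupport φ ⊆ K := Metric.self_subset_cthickening _
  set e := EuclideanSpace.single i (1 : ℝ) with he
  have hde : tsupport (fun x => fderiv ℝ φ x e) ⊆ tsupport φ :=
    tsupport_fderiv_apply_const_subset φ e
  obtain ⟨ρ, hρ, hρ', hρδ⟩ := exists_seq_contDiffBump (n := n) hδ
  have hint : ∀ u : EuclideanSpace ℝ (Fin n) → ℝ, LocallyIntegrableOn u Ω volume →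
      Integrable (K.indicator u) volume := fun u hu =>
    (hu.integrableOn_compact_subset hδΩ hKc).integrable_indicator hKc.measurableSet
  have hbdd : ∀ u, LocallyEssBoundedOn Ω u → ∃ M, ∀ᵐ x, |K.indicator u x| ≤ M := by
    intro u hu
    obtain ⟨M, hM⟩ := hu K hδΩ hKc
    refine ⟨max M 0, ?_⟩
    rw [ae_restrict_iff' hKc.measurableSet] at hM
    filter_upwards [hM] with x hx
    by_cases hxK : x ∈ K
    · simp [hxK, hx hxK]
    · simp [hxK]
  obtain ⟨M, hM⟩ := hbdd f hfb
  have hgφb : LocallyEssBoundedOn Ω fun x => g x * φ x :=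
    hgb.mul (.of_continuousOn hφ.continuous.continuousOn)
  obtain ⟨N, hN⟩ := hbdd _ hgφb
  have hgφ : K.indicator (fun x => g x * φ x) = fun x => g x * φ x :=
    indicator_eq_self.2 fun x hx => hsK (subset_tsupport φ fun h0 => hx (by simp [h0]))
  rw [hgφ] at hN
  have i1 : Integrable (fun x => g x * fderiv ℝ φ x e) volume :=
    integrable_mul_fderiv_of_tsupport_subset hg.1 hφ hc hs e
  have i2 : Integrable (fun x => g x * φ x) volume :=
    integrable_mul_of_tsupport_subset hg.1 hφ.continuous hc hs
  have i3 : Integrable (fun x => g' x * φ x) volume :=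
    integrable_mul_of_tsupport_subset hg.2.1 hφ.continuous hc hs
  have t1 := tendsto_integral_mollify_mul hρ hρ' hM (hint f hf.1).locallyIntegrable i1
  have t2 := tendsto_integral_mollify_mul hρ hρ' hN i2.locallyIntegrable (hint f' hf.2.1)
  have t3 := tendsto_integral_mollify_mul hρ hρ' hM (hint f hf.1).locallyIntegrable i3
  -- The definition of `g'` is tested against `m φ`, with `m` the mollified `f`. In the term with
  -- `∂_i m`, the mollifier is moved from `f'` onto the bounded function `g φ`, so that
  -- integrability of `f'` suffices in the limit.
  have hkey : ∀ k, (∫ x, mollify (ρ k) (K.indicator f) x * (g x * fderiv ℝ φ x e)) +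
      (∫ x, mollify (ρ k) (fun x => g x * φ x) x * K.indicator f' x) =
      -∫ x, mollify (ρ k) (K.indicator f) x * (g' x * φ x) := by
    intro k
    have hm := contDiff_mollify (ρ k) (hint f hf.1).locallyIntegrable
    have hm' := contDiff_mollify (ρ k) (hint f' hf.2.1).locallyIntegrable
    set m := mollify (ρ k) (K.indicator f) with hmdef
    have hψt : tsupport (fun x => m x * φ x) ⊆ tsupport φ :=
      closure_mono (Function.support_mul_subset_right m φ)
    have hψc : HasCompactSupport (fun x => m x * φ x) := hc.mul_left
    have key := hg.2.2 _ (hm.mul hφ) hψc (hψt.trans hs)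
    have hd : ∀ x, fderiv ℝ (fun x => m x * φ x) x e =
        m x * fderiv ℝ φ x e + mollify (ρ k) (K.indicator f') x * φ x := by
      intro x
      rw [fderiv_fun_mul (hm.differentiable (by simp) x) (hφ.differentiable (by simp) x)]
      by_cases hx : x ∈ tsupport φ
      · have := hf.fderiv_mollify hKc hδΩ (ρ k) (x := x)
          ((Metric.closedBall_subset_closedBall (hρδ k)).trans
            (Metric.closedBall_subset_cthickening hx δ))
        simp only [← he, ← hmdef] at this
        simp [this, mul_comm]
      · simp [image_eq_zero_of_notMem_tsupport hx]
    rw [setIntegral_mul_of_tsupport_subset ((tsupport_fderiv_apply_const_subset _ e).trans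
        (hψt.trans hs)), setIntegral_mul_of_tsupport_subset (hψt.trans hs)] at key
    rw [integral_mollify_mul (ρ k) i2 (hint f' hf.2.1), ← integral_add]
    · calc _ = ∫ x, g x * fderiv ℝ (fun x => m x * φ x) x e := by
            refine integral_congr_ae (Filter.Eventually.of_forall fun x => ?_)
            simp only [hd]
            ring
        _ = _ := by
            rw [key]
            congr 1
            refine integral_congr_ae (Filter.Eventually.of_forall fun x => ?_)
            simp only
            ring
    · have : Integrable (fun x => g x * (m x * fderiv ℝ φ x e)) volume :=
        integrable_mul_of_tsupport_subset hg.1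
          (hm.continuous.mul ((hφ.continuous_fderiv (by simp)).clm_apply continuous_const))
          (hasCompactSupport_fderiv_apply_const hc e).mul_left
          ((closure_mono (Function.support_mul_subset_right m _)).trans (hde.trans hs))
      exact this.congr (Filter.Eventually.of_forall fun x => by simp only; ring)
    · have : Integrable (fun x => g x * (φ x * mollify (ρ k) (K.indicator f') x)) volume :=
        integrable_mul_of_tsupport_subset hg.1 (hφ.continuous.mul hm'.continuous)
          hc.mul_right
          ((closure_mono (Function.support_mul_subset_left φ _)).trans hs)
      exact this.congr (Filter.Eventually.of_forall fun x => by simp only; ring)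
  have hlim := tendsto_nhds_unique ((t1.add t2).congr hkey) t3.neg
  have j1 := integrable_mul_of_tsupport_subset l1 hφ.continuous hc hs
  have j2 := integrable_mul_of_tsupport_subset l2 hφ.continuous hc hs
  rw [setIntegral_mul_of_tsupport_subset (hde.trans hs), setIntegral_mul_of_tsupport_subset hs]
  simp only [add_mul]
  rw [integral_add j1 j2]
  have r1 : ∫ x, f x * g x * fderiv ℝ φ x e =
      ∫ x, K.indicator f x * (g x * fderiv ℝ φ x e) := by
    refine integral_congr_ae (Filter.Eventually.of_forall fun x => ?_)
    by_cases hx : x ∈ K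
    · simp [hx, mul_assoc]
    · have : fderiv ℝ φ x e = 0 := image_eq_zero_of_notMem_tsupport
        (f := fun x => fderiv ℝ φ x e) fun h => hx (hsK (hde h))
      simp [this]
  have r2 : ∫ x, f' x * g x * φ x = ∫ x, g x * φ x * K.indicator f' x := by
    refine integral_congr_ae (Filter.Eventually.of_forall fun x => ?_)
    by_cases hx : x ∈ K
    · simp only [hx, indicator_of_mem]
      ring
    · simp [image_eq_zero_of_notMem_tsupport fun h => hx (hsK h)]
  have r3 : ∫ x, f x * g' x * φ x = ∫ x, K.indicator f x * (g' x * φ x) := by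
    refine integral_congr_ae (Filter.Eventually.of_forall fun x => ?_)
    by_cases hx : x ∈ K
    · simp [hx, mul_assoc]
    · simp [image_eq_zero_of_notMem_tsupport fun h => hx (hsK h)]
  rw [r1, r2, r3]
  linarith

/-! ### Locally Lipschitz functions -/

/-- Rademacher's theorem for locally Lipschitz functions on an open set. -/
theorem LocallyLipschitzOn.ae_differentiableAt {n : ℕ} {Ω : Set (EuclideanSpace ℝ (Fin n))}
    (hΩ : IsOpen Ω) {F : Type*} [NormedAddCommGroup F] [NormedSpace ℝ F] [FiniteDimensional ℝ F]
    {f : EuclideanSpace ℝ (Fin n) → F} (hf : LocallyLipschitzOn Ω f) :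
    ∀ᵐ x ∂volume.restrict Ω, DifferentiableAt ℝ f x := by
  rw [ae_restrict_iff' hΩ.measurableSet, ae_iff]
  refine measure_null_of_locally_null _ fun x hx => ?_
  have hxΩ : x ∈ Ω := by
    by_contra h
    exact hx fun h' => absurd h' h
  obtain ⟨C, t, ht, hl⟩ := hf hxΩ
  rw [hΩ.nhdsWithin_eq hxΩ] at ht
  refine ⟨_, inter_mem_nhdsWithin _ (interior_mem_nhds.2 ht), ?_⟩
  have := (hl.mono interior_subset).ae_differentiableWithinAt_of_mem (μ := volume)
  rw [ae_iff] at this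
  refine measure_mono_null ?_ this
  intro y hy hd
  exact hy.1 fun _ => (hd hy.2).differentiableAt (isOpen_interior.mem_nhds hy.2)

/-- Integration by parts holds for globally Lipschitz functions. On a compact `K' ⊆ Ω`, `f` is
Lipschitz and agrees with a global Lipschitz extension. Choosing `K'` with the given compact set in
its interior makes the derivatives agree there too. -/
theorem LocallyLipschitzOn.isWeakPartial {n : ℕ} {Ω : Set (EuclideanSpace ℝ (Fin n))}
    (hΩ : IsOpen Ω) {f : EuclideanSpace ℝ (Fin n) → ℝ} (hf : LocallyLipschitzOn Ω f)
    (i : Fin n) : IsWeakPartial Ω i f (partialDeriv i f) := by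
  have hext : ∀ K ⊆ Ω, IsCompact K → ∃ g : EuclideanSpace ℝ (Fin n) → ℝ,
      (∃ C, LipschitzWith C g) ∧ EqOn f g K := by
    intro K hK hc
    obtain ⟨C, hC⟩ := (hf.mono hK).exists_lipschitzOnWith_of_compact hc
    obtain ⟨g, hg, hfg⟩ := hC.extend_real
    exact ⟨g, ⟨C, hg⟩, hfg⟩
  have hnear : ∀ K ⊆ Ω, IsCompact K → ∃ K' ⊆ Ω, IsCompact K' ∧ K ⊆ interior K' := by
    intro K hK hc
    obtain ⟨K', h1, h2, h3⟩ := exists_compact_between hc hΩ hK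
    exact ⟨K', h3, h1, h2⟩
  have heq : ∀ (g : EuclideanSpace ℝ (Fin n) → ℝ) (K' : Set (EuclideanSpace ℝ (Fin n))),
      EqOn f g K' → (∃ C, LipschitzWith C g) → ∀ᵐ x, x ∈ interior K' →
      partialDeriv i f x = lineDeriv ℝ g x (EuclideanSpace.single i 1) := by
    rintro g K' hfg ⟨C, hC⟩
    filter_upwards [hC.ae_differentiableAt (μ := volume)] with x hx hxK
    rw [hx.lineDeriv_eq_fderiv, partialDeriv,
      (hfg.eventuallyEq_of_mem (mem_interior_iff_mem_nhds.1 hxK)).fderiv_eq]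
  refine ⟨hf.continuousOn.locallyIntegrableOn hΩ.measurableSet, ?_, fun φ hφ hc hs => ?_⟩
  · rw [locallyIntegrableOn_iff hΩ.isLocallyClosed]
    intro K hK hKc
    obtain ⟨K', h1, h2, h3⟩ := hnear K hK hKc
    obtain ⟨g, ⟨C, hC⟩, hfg⟩ := hext K' h1 h2
    refine ((hC.locallyIntegrable_lineDeriv (μ := volume)
      (EuclideanSpace.single i 1)).integrableOn_isCompact hKc).congr_fun_ae ?_
    rw [Filter.EventuallyEq, ae_restrict_iff' hKc.measurableSet]
    filter_upwards [heq g K' hfg ⟨C, hC⟩] with x hx hxK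
    exact (hx (h3 hxK)).symm
  · obtain ⟨K', h1, h2, h3⟩ := hnear _ hs hc
    obtain ⟨g, ⟨C, hC⟩, hfg⟩ := hext K' h1 h2
    obtain ⟨D, hD⟩ := hφ.lipschitzWith_of_hasCompactSupport hc (by simp)
    have key := hC.integral_lineDeriv_mul_eq hD hc (EuclideanSpace.single i 1) (μ := volume)
    have hd : ∀ x, lineDeriv ℝ φ x (-EuclideanSpace.single i 1) =
        -fderiv ℝ φ x (EuclideanSpace.single i 1) := fun x => by
      rw [(hφ.differentiable (by simp) x).lineDeriv_eq_fderiv, map_neg]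
    rw [setIntegral_mul_of_tsupport_subset ((tsupport_fderiv_apply_const_subset φ _).trans hs),
      setIntegral_mul_of_tsupport_subset hs]
    have e1 : ∫ x, partialDeriv i f x * φ x =
        ∫ x, lineDeriv ℝ g x (EuclideanSpace.single i 1) * φ x := by
      refine integral_congr_ae ?_
      filter_upwards [heq g K' hfg ⟨C, hC⟩] with x hx
      by_cases hxs : x ∈ tsupport φ
      · rw [hx (h3 hxs)]
      · simp [image_eq_zero_of_notMem_tsupport hxs]
    rw [e1, key, ← integral_neg]
    refine integral_congr_ae (Filter.Eventually.of_forall fun x => ?_)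
    simp only [hd]
    by_cases hxs : x ∈ tsupport φ
    · rw [hfg (interior_subset (h3 hxs))]
      ring
    · have : fderiv ℝ φ x (EuclideanSpace.single i 1) = 0 := image_eq_zero_of_notMem_tsupport
        (f := fun x => fderiv ℝ φ x (EuclideanSpace.single i 1))
        fun h => hxs (tsupport_fderiv_apply_const_subset φ _ h)
      simp [this]

/-! ### Bilipschitz changes of variables -/

/-- The `n`-dimensional Hausdorff measure is a Haar measure, so it has the same null sets as
`volume`, and a Lipschitz map enlarges it by at most the factor `C ^ n`. -/
theorem LipschitzOnWith.volume_image_eq_zero {n : ℕ} {N : Set (EuclideanSpace ℝ (Fin n))}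
    {C : ℝ≥0} {f : EuclideanSpace ℝ (Fin n) → EuclideanSpace ℝ (Fin n)}
    (hf : LipschitzOnWith C f N) (hN : volume N = 0) : volume (f '' N) = 0 := by
  have : Measure.IsAddHaarMeasure
      (Measure.hausdorffMeasure (n : ℝ) : Measure (EuclideanSpace ℝ (Fin n))) := by
    simpa using isAddHaarMeasure_hausdorffMeasure (E := EuclideanSpace ℝ (Fin n))
  have h1 : (Measure.hausdorffMeasure (n : ℝ) : Measure (EuclideanSpace ℝ (Fin n))) N = 0 :=
    Measure.absolutelyContinuous_isAddHaarMeasure _ volume hN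
  refine Measure.absolutelyContinuous_isAddHaarMeasure volume
    (Measure.hausdorffMeasure (n : ℝ) : Measure (EuclideanSpace ℝ (Fin n))) ?_
  simpa [h1] using hf.hausdorffMeasure_image_le (d := n) (Nat.cast_nonneg n)

theorem BilipschitzOn.injOn {n : ℕ} {Ω : Set (EuclideanSpace ℝ (Fin n))}
    {ξ : EuclideanSpace ℝ (Fin n) → EuclideanSpace ℝ (Fin n)} (hξ : BilipschitzOn Ω ξ) :
    InjOn ξ Ω := by
  obtain ⟨K, -, h⟩ := hξ
  intro x hx y hy hxy
  have := (h x hx y hy).2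
  rw [hxy, dist_self, mul_zero] at this
  exact dist_le_zero.1 this

theorem BilipschitzOn.exists_lipschitzOnWith {n : ℕ} {Ω : Set (EuclideanSpace ℝ (Fin n))}
    {ξ : EuclideanSpace ℝ (Fin n) → EuclideanSpace ℝ (Fin n)} (hξ : BilipschitzOn Ω ξ) :
    ∃ C : ℝ≥0, LipschitzOnWith C ξ Ω := by
  obtain ⟨K, hK, h⟩ := hξ
  exact ⟨⟨K, hK.le⟩, LipschitzOnWith.of_dist_le_mul fun x hx y hy => (h x hx y hy).1⟩

theorem BilipschitzOn.exists_lipschitzOnWith_invFunOn {n : ℕ}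
    {Ω : Set (EuclideanSpace ℝ (Fin n))}
    {ξ : EuclideanSpace ℝ (Fin n) → EuclideanSpace ℝ (Fin n)} (hξ : BilipschitzOn Ω ξ) :
    ∃ C : ℝ≥0, LipschitzOnWith C (Function.invFunOn ξ Ω) (ξ '' Ω) := by
  have hinj := hξ.injOn
  obtain ⟨K, hK, h⟩ := hξ
  refine ⟨⟨K, hK.le⟩, LipschitzOnWith.of_dist_le_mul ?_⟩
  rintro _ ⟨x, hx, rfl⟩ _ ⟨y, hy, rfl⟩
  rw [hinj.leftInvOn_invFunOn hx, hinj.leftInvOn_invFunOn hy]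
  exact (h x hx y hy).2

/-- A bilipschitz change of variables preserves null sets. -/
theorem BilipschitzOn.ae_comp {n : ℕ} {Ω : Set (EuclideanSpace ℝ (Fin n))}
    {ξ : EuclideanSpace ℝ (Fin n) → EuclideanSpace ℝ (Fin n)} (hξ : BilipschitzOn Ω ξ)
    (hΩ : IsOpen Ω) (hU : IsOpen (ξ '' Ω)) {p : EuclideanSpace ℝ (Fin n) → Prop}
    (hp : ∀ᵐ u ∂volume.restrict (ξ '' Ω), p u) : ∀ᵐ x ∂volume.restrict Ω, p (ξ x) := by
  obtain ⟨C, hC⟩ := hξ.exists_lipschitzOnWith_invFunOn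
  rw [ae_restrict_iff' hU.measurableSet, ae_iff] at hp
  rw [ae_restrict_iff' hΩ.measurableSet, ae_iff]
  have hsub : {u | ¬(u ∈ ξ '' Ω → p u)} ⊆ ξ '' Ω := fun u hu => by
    by_contra h
    exact hu fun h' => absurd h' h
  -- The exceptional set in `Ω` lies in the image, under the Lipschitz map `ξ⁻¹`, of the null
  -- exceptional set in `ξ(Ω)`.
  refine measure_mono_null (fun x hx => ?_) ((hC.mono hsub).volume_image_eq_zero hp)
  simp only [mem_ofPred_eq, Classical.not_imp] at hx
  refine ⟨ξ x, ?_, hξ.injOn.leftInvOn_invFunOn hx.1⟩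
  simp only [mem_ofPred_eq, Classical.not_imp]
  exact ⟨mem_image_of_mem ξ hx.1, hx.2⟩

theorem LocallyLipschitzOn.comp_lipschitzOnWith {α β γ : Type*} [PseudoEMetricSpace α]
    [PseudoEMetricSpace β] [PseudoEMetricSpace γ] {f : β → γ} {g : α → β} {s : Set α}
    {t : Set β} {C : ℝ≥0} (hf : LocallyLipschitzOn t f) (hg : LipschitzOnWith C g s)
    (hst : MapsTo g s t) : LocallyLipschitzOn s (f ∘ g) := by
  intro x hx
  obtain ⟨K, v, hv, hK⟩ := hf (hst hx)
  refine ⟨K * C, s ∩ g ⁻¹' v, ?_, hK.comp (hg.mono inter_subset_left) fun y hy => hy.2⟩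
  exact Filter.inter_mem self_mem_nhdsWithin
    ((hg.continuousOn x hx).tendsto_nhdsWithin hst hv)

theorem LipschitzOnWith.locallyLipschitzOn_self {α β : Type*} [PseudoEMetricSpace α]
    [PseudoEMetricSpace β] {f : α → β} {s : Set α} {C : ℝ≥0} (hf : LipschitzOnWith C f s) :
    LocallyLipschitzOn s f :=
  fun _ _ => ⟨C, s, self_mem_nhdsWithin, hf⟩

/-- The chain rule for `f = (f ∘ ξ⁻¹) ∘ ξ`. -/
theorem BilipschitzOn.ae_partialDeriv_eq {n : ℕ} {Ω : Set (EuclideanSpace ℝ (Fin n))}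
    {ξ : EuclideanSpace ℝ (Fin n) → EuclideanSpace ℝ (Fin n)} (hξ : BilipschitzOn Ω ξ)
    (hΩ : IsOpen Ω) (hU : IsOpen (ξ '' Ω)) {f : EuclideanSpace ℝ (Fin n) → ℝ}
    (hf : LocallyLipschitzOn Ω f) (k : Fin n) :
    ∀ᵐ x ∂volume.restrict Ω, partialDeriv k f x =
      ∑ p, partialDeriv p (fun u => f (Function.invFunOn ξ Ω u)) (ξ x) *
        partialDeriv k (fun y => ξ y p) x := by
  obtain ⟨C, hC⟩ := hξ.exists_lipschitzOnWith_invFunOn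
  obtain ⟨D, hD⟩ := hξ.exists_lipschitzOnWith
  have hmaps : MapsTo (Function.invFunOn ξ Ω) (ξ '' Ω) Ω := by
    rintro _ ⟨x, hx, rfl⟩
    rwa [hξ.injOn.leftInvOn_invFunOn hx]
  -- Differentiability of `f ∘ ξ⁻¹` is needed at `ξ x`: Rademacher's theorem on `ξ(Ω)`, pulled back
  -- to almost every `x`.
  have h1 := hξ.ae_comp hΩ hU ((hf.comp_lipschitzOnWith hC hmaps).ae_differentiableAt hU)
  have h2 := hD.locallyLipschitzOn_self.ae_differentiableAt hΩ
  filter_upwards [h1, h2, ae_restrict_mem hΩ.measurableSet] with x hx1 hx2 hxΩ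
  set H := f ∘ Function.invFunOn ξ Ω with hH
  have e1 : f =ᶠ[𝓝 x] H ∘ ξ := by
    filter_upwards [hΩ.mem_nhds hxΩ] with y hy
    simp [hH, hξ.injOn.leftInvOn_invFunOn hy]
  have e2 : ∀ p, partialDeriv k (fun y => ξ y p) x =
      fderiv ℝ ξ x (EuclideanSpace.single k 1) p := by
    intro p
    have : HasFDerivAt (fun y => ξ y p)
        ((EuclideanSpace.proj p : EuclideanSpace ℝ (Fin n) →L[ℝ] ℝ) ∘L fderiv ℝ ξ x) x :=
      (EuclideanSpace.proj p : EuclideanSpace ℝ (Fin n) →L[ℝ] ℝ).hasFDerivAt.comp x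
        hx2.hasFDerivAt
    rw [partialDeriv, this.fderiv]
    rfl
  simp only [e2]
  rw [partialDeriv, e1.fderiv_eq, fderiv_comp x hx1 hx2, ContinuousLinearMap.comp_apply]
  set w := fderiv ℝ ξ x (EuclideanSpace.single k 1) with hw
  have e3 : w = ∑ p, w p • EuclideanSpace.single p (1 : ℝ) := by
    ext q
    simp [Pi.single_apply]
  conv_lhs => rw [e3]
  rw [map_sum]
  refine Finset.sum_congr rfl fun p _ => ?_
  rw [map_smul, smul_eq_mul, mul_comm]
  rfl

/-! ### Matrix algebra of the Koszul formula -/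

/-- The Koszul formula, solved for the second derivatives `S k a i = ∂_k ∂_i ξ^a`. -/
theorem hessian_eq_of_transpose_mul_mul {n : ℕ} {F G Gt : Matrix (Fin n) (Fin n) ℝ}
    {S dG dGt : Fin n → Matrix (Fin n) (Fin n) ℝ} (hS : ∀ k i a, S k a i = S i a k)
    (hG : G.IsSymm) (hFG : Fᵀ * G * F = Gt) (hGt : IsUnit Gt.det)
    (hd : ∀ k, dGt k = (S k)ᵀ * G * F + Fᵀ * dG k * F + Fᵀ * G * S k) (i j : Fin n) :
    (fun a => S i a j) = (F * Gt⁻¹) *ᵥ fun k =>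
      1 / 2 * (dGt i j k + dGt j i k - dGt k i j) -
      1 / 2 * ((Fᵀ * dG i * F) j k + (Fᵀ * dG j * F) i k - (Fᵀ * dG k * F) i j) := by
  have hA : ∀ k i j, ((S k)ᵀ * G * F) i j = ((S i)ᵀ * G * F) k j := by
    intro k i j
    simp only [Matrix.mul_assoc (S _)ᵀ, Matrix.mul_apply (M := (S _)ᵀ), Matrix.transpose_apply,
      hS k i]
  have hA' : ∀ k i j, (Fᵀ * G * S k) i j = ((S k)ᵀ * G * F) j i := by
    intro k i j
    rw [← Matrix.transpose_apply ((S k)ᵀ * G * F), Matrix.transpose_mul, Matrix.transpose_mul,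
      Matrix.transpose_transpose, hG.eq, Matrix.mul_assoc]
  have hR : (fun k => 1 / 2 * (dGt i j k + dGt j i k - dGt k i j) -
      1 / 2 * ((Fᵀ * dG i * F) j k + (Fᵀ * dG j * F) i k - (Fᵀ * dG k * F) i j)) =
      (Fᵀ * G) *ᵥ fun a => S i a j := by
    funext k
    have : ((Fᵀ * G) *ᵥ fun a => S i a j) k = ((S i)ᵀ * G * F) j k := by
      rw [← hA', Matrix.mul_apply]
      rfl
    rw [this]
    simp only [hd, Matrix.add_apply, hA']
    -- The terms in `dG` have cancelled. Of the six remaining terms, symmetry of the second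
    -- derivatives cancels four and makes the other two equal.
    rw [hA j i k, hA k j i, hA k i j]
    ring
  rw [hR, Matrix.mulVec_mulVec]
  -- Invertibility of `F` is not assumed. It follows from that of `Gt`, since a left inverse of a
  -- square matrix is also a right inverse.
  have h1 : Gt⁻¹ * (Fᵀ * G) * F = 1 := by
    rw [Matrix.mul_assoc, hFG, Matrix.nonsing_inv_mul _ hGt]
  have h2 : F * Gt⁻¹ * (Fᵀ * G) = 1 := by
    rw [Matrix.mul_assoc]
    exact mul_eq_one_comm.1 h1
  rw [h2, Matrix.one_mulVec]

/-- Turns the prefactor `F * Gt⁻¹` of the Hessian formula, followed by the `Fᵀ` of the chain rule,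
into the inverse metric in `Γ`. -/
theorem mul_inv_mul_transpose_eq_inv {n : ℕ} {F G Gt : Matrix (Fin n) (Fin n) ℝ}
    (hFG : Fᵀ * G * F = Gt) (hGt : IsUnit Gt.det) : F * Gt⁻¹ * Fᵀ = G⁻¹ := by
  have h1 : Gt⁻¹ * (Fᵀ * G) * F = 1 := by
    rw [Matrix.mul_assoc, hFG, Matrix.nonsing_inv_mul _ hGt]
  refine (Matrix.inv_eq_left_inv ?_).symm
  rw [Matrix.mul_assoc, Matrix.mul_assoc]
  exact mul_eq_one_comm.1 h1

/-- The change of variables in the derivatives of the metric. -/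
theorem transpose_mul_mul_koszul {n : ℕ} {F : Matrix (Fin n) (Fin n) ℝ}
    {dG dH : Fin n → Matrix (Fin n) (Fin n) ℝ} (hH : ∀ k, (dH k).IsSymm)
    (hd : ∀ k a b, dG k a b = ∑ p, dH p a b * F p k) (i j : Fin n) :
    (fun k => (Fᵀ * dG i * F) j k + (Fᵀ * dG j * F) i k - (Fᵀ * dG k * F) i j) =
      Fᵀ *ᵥ fun c => ∑ p, ∑ q, F p i * F q j * (dH q c p + dH p c q - dH c p q) := by
  have hB : ∀ k i j, (Fᵀ * dG k * F) i j =
      ∑ a, ∑ b, ∑ p, F a i * F b j * F p k * dH p a b := by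
    intro k i j
    rw [Matrix.mul_assoc, Matrix.mul_apply]
    refine Finset.sum_congr rfl fun a _ => ?_
    rw [Matrix.mul_apply, Finset.mul_sum]
    refine Finset.sum_congr rfl fun b _ => ?_
    rw [hd, Finset.sum_mul, Finset.mul_sum]
    refine Finset.sum_congr rfl fun p _ => ?_
    rw [Matrix.transpose_apply]
    ring
  funext k
  rw [hB, hB, hB]
  -- In `e1`, `e2`, `e3` the summation indices are renamed so that `c`, `p`, `q` always accompany
  -- the free indices `k`, `i`, `j`. Symmetry of `dH` then gives the order of indices used in
  -- `christoffel`.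
  have e1 : ∑ a, ∑ b, ∑ p, F a j * F b k * F p i * dH p a b =
      ∑ c, ∑ p, ∑ q, F c k * (F p i * F q j * dH p c q) := by
    rw [Finset.sum_comm]
    refine Finset.sum_congr rfl fun c _ => ?_
    rw [Finset.sum_comm]
    refine Finset.sum_congr rfl fun p _ => Finset.sum_congr rfl fun q _ => ?_
    rw [(hH p).apply c q]
    ring
  have e2 : ∑ a, ∑ b, ∑ p, F a i * F b k * F p j * dH p a b =
      ∑ c, ∑ p, ∑ q, F c k * (F p i * F q j * dH q c p) := by
    rw [Finset.sum_comm]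
    refine Finset.sum_congr rfl fun c _ => ?_
    refine Finset.sum_congr rfl fun p _ => Finset.sum_congr rfl fun q _ => ?_
    rw [(hH q).apply c p]
    ring
  have e3 : ∑ a, ∑ b, ∑ p, F a i * F b j * F p k * dH p a b =
      ∑ c, ∑ p, ∑ q, F c k * (F p i * F q j * dH c p q) := by
    rw [Finset.sum_congr rfl fun a _ => Finset.sum_comm, Finset.sum_comm]
    refine Finset.sum_congr rfl fun c _ => Finset.sum_congr rfl fun p _ =>
      Finset.sum_congr rfl fun q _ => ?_
    ring
  rw [e1, e2, e3]
  simp only [Matrix.mulVec, dotProduct, Matrix.transpose_apply, Finset.mul_sum,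
    ← Finset.sum_add_distrib, ← Finset.sum_sub_distrib]
  refine Finset.sum_congr rfl fun c _ => Finset.sum_congr rfl fun p _ =>
    Finset.sum_congr rfl fun q _ => ?_
  ring

/-! ### Coercive matrices and symmetry of the metric -/

theorem isUnit_det_of_coercive {n : ℕ} {A : Matrix (Fin n) (Fin n) ℝ} {c : ℝ} (hc : 0 < c)
    (hA : ∀ v : Fin n → ℝ, c * (v ⬝ᵥ v) ≤ v ⬝ᵥ (A *ᵥ v)) : IsUnit A.det := by
  rw [isUnit_iff_ne_zero]
  intro h
  obtain ⟨v, hv, hAv⟩ := Matrix.exists_mulVec_eq_zero_iff.2 h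
  have h1 := hA v
  rw [hAv, dotProduct_zero] at h1
  have h2 : 0 < v ⬝ᵥ v := by
    refine lt_of_le_of_ne (Finset.sum_nonneg fun i _ => mul_self_nonneg _) fun h0 => hv ?_
    exact dotProduct_self_eq_zero.1 h0.symm
  exact absurd h1 (not_le.2 (mul_pos hc h2))

/-- For the column `v = A⁻¹ e_k`, coercivity reads `c |v|² ≤ v_k`. This gives first `v_k ≤ 1 / c`
and then `|v|² ≤ 1 / c²`. -/
theorem abs_inv_apply_le_of_coercive {n : ℕ} {A : Matrix (Fin n) (Fin n) ℝ} {c : ℝ} (hc : 0 < c)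
    (hA : ∀ v : Fin n → ℝ, c * (v ⬝ᵥ v) ≤ v ⬝ᵥ (A *ᵥ v)) (m k : Fin n) :
    |A⁻¹ m k| ≤ 1 / c := by
  set v : Fin n → ℝ := fun m => A⁻¹ m k with hv
  have h1 : A *ᵥ v = Pi.single k 1 := by
    have : v = A⁻¹ *ᵥ Pi.single k 1 := by
      funext m
      simp [hv]
    rw [this, Matrix.mulVec_mulVec, Matrix.mul_nonsing_inv _ (isUnit_det_of_coercive hc hA),
      Matrix.one_mulVec]
  have h2 := hA v
  rw [h1, dotProduct_single, mul_one] at h2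
  have h3 : ∀ l, v l * v l ≤ v ⬝ᵥ v := fun l =>
    Finset.single_le_sum (f := fun l => v l * v l) (fun i _ => mul_self_nonneg _)
      (Finset.mem_univ l)
  have h4 : c * (v k * v k) ≤ v k := (mul_le_mul_of_nonneg_left (h3 k) hc.le).trans h2
  have h5 : v k ≤ 1 / c := by
    rw [le_div_iff₀ hc]
    by_contra h
    push Not at h
    nlinarith [mul_self_nonneg (v k)]
  have h6 : v m * v m ≤ 1 / c * (1 / c) := by
    have : c * (v m * v m) ≤ 1 / c := (mul_le_mul_of_nonneg_left (h3 m) hc.le).trans (h2.trans h5)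
    rw [mul_comm] at this
    rw [← div_eq_mul_one_div]
    exact (le_div_iff₀ hc).2 this
  exact abs_le_of_sq_le_sq (by simpa only [sq] using h6) (by positivity)

theorem partialDeriv_isSymm {n : ℕ} {V : Set (EuclideanSpace ℝ (Fin n))} (hV : IsOpen V)
    {G : EuclideanSpace ℝ (Fin n) → Matrix (Fin n) (Fin n) ℝ} (hG : ∀ x ∈ V, (G x).IsSymm)
    {x : EuclideanSpace ℝ (Fin n)} (hx : x ∈ V) (k a b : Fin n) :
    partialDeriv k (fun y => G y a b) x = partialDeriv k (fun y => G y b a) x := by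
  have : (fun y => G y a b) =ᶠ[𝓝 x] fun y => G y b a := by
    filter_upwards [hV.mem_nhds hx] with y hy
    exact (hG y hy).apply b a
  rw [partialDeriv, partialDeriv, this.fderiv_eq]

/-! ### Chosen weak derivatives and essential bounds -/

theorem isWeakPartial_weakPartial {n : ℕ} {Ω : Set (EuclideanSpace ℝ (Fin n))} {i : Fin n}
    {f g : EuclideanSpace ℝ (Fin n) → ℝ} (h : IsWeakPartial Ω i f g) :
    IsWeakPartial Ω i f (weakPartial Ω i f) := by
  have h' : ∃ g, IsWeakPartial Ω i f g := ⟨g, h⟩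
  rw [weakPartial, dif_pos h']
  exact h'.choose_spec

/-- The representative chosen by `weakPartial` may differ from the one witnessing Sobolev
regularity. They agree almost everywhere, so the chosen one is weakly differentiable too. -/
theorem MemSobolev.isWeakPartial_weakPartial {n : ℕ} {Ω : Set (EuclideanSpace ℝ (Fin n))}
    (hΩ : IsOpen Ω) {p : ℝ≥0∞} {f : EuclideanSpace ℝ (Fin n) → ℝ} (hf : MemSobolev Ω p 2 f)
    (i j : Fin n) :
    IsWeakPartial Ω j f (weakPartial Ω j f) ∧
      IsWeakPartial Ω i (weakPartial Ω j f) (weakPartial Ω i (weakPartial Ω j f)) := by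
  obtain ⟨g, hg, -, hg'⟩ := hf.2 j
  obtain ⟨g', hg'', -⟩ := hg' i
  have h1 := _root_.isWeakPartial_weakPartial hg
  exact ⟨h1, _root_.isWeakPartial_weakPartial
    (hg''.congr hΩ (hg.ae_eq hΩ h1) Filter.EventuallyEq.rfl)⟩

/-- Essential boundedness is treated as `O(1)` along the almost-everywhere filter, so that sums and
products need no explicit constants. -/
theorem isBigO_one_ae_of_abs_le {α : Type*} [MeasurableSpace α] {μ : Measure α} {f : α → ℝ}
    {C : ℝ} (h : ∀ᵐ x ∂μ, |f x| ≤ C) : f =O[ae μ] fun _ => (1 : ℝ) :=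
  Asymptotics.IsBigO.of_bound C (by simpa using h)

theorem isBigO_one_mul {α : Type*} {l : Filter α} {f g : α → ℝ} (hf : f =O[l] fun _ => (1 : ℝ))
    (hg : g =O[l] fun _ => (1 : ℝ)) : (fun x => f x * g x) =O[l] fun _ => (1 : ℝ) := by
  simpa using hf.mul hg

theorem isBigO_one_sum {α ι : Type*} {l : Filter α} {s : Finset ι} {f : ι → α → ℝ}
    (hf : ∀ a ∈ s, f a =O[l] fun _ => (1 : ℝ)) :
    (fun x => ∑ a ∈ s, f a x) =O[l] fun _ => (1 : ℝ) :=
  (Asymptotics.IsBigO.sum hf).congr_left fun x => by simp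

theorem memLp_top_of_isBigO_one {α : Type*} [MeasurableSpace α] {μ : Measure α} {f : α → ℝ}
    (hm : AEStronglyMeasurable f μ) (h : f =O[ae μ] fun _ => (1 : ℝ)) : MemLp f ∞ μ := by
  obtain ⟨C, hC⟩ := h.bound
  exact memLp_top_of_bound hm C (by simpa using hC)

theorem BilipschitzOn.exists_lipschitzOnWith_apply {n : ℕ} {Ω : Set (EuclideanSpace ℝ (Fin n))}
    {ξ : EuclideanSpace ℝ (Fin n) → EuclideanSpace ℝ (Fin n)} (hξ : BilipschitzOn Ω ξ)
    (s : Fin n) : ∃ C : ℝ≥0, LipschitzOnWith C (fun y => ξ y s) Ω := by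
  obtain ⟨D, hD⟩ := hξ.exists_lipschitzOnWith
  exact ⟨D, LipschitzOnWith.of_dist_le_mul fun x hx y hy =>
    (PiLp.dist_apply_le (ξ x) (ξ y) s).trans (hD.dist_le_mul x hx y hy)⟩

theorem BilipschitzOn.weakPartial_ae_eq {n : ℕ} {Ω : Set (EuclideanSpace ℝ (Fin n))}
    {ξ : EuclideanSpace ℝ (Fin n) → EuclideanSpace ℝ (Fin n)} (hξ : BilipschitzOn Ω ξ)
    (hΩ : IsOpen Ω) (k s : Fin n) :
    weakPartial Ω k (fun y => ξ y s) =ᵐ[volume.restrict Ω] partialDeriv k fun y => ξ y s := by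
  obtain ⟨D, h1⟩ := hξ.exists_lipschitzOnWith_apply s
  have h2 := h1.locallyLipschitzOn_self.isWeakPartial hΩ k
  exact (isWeakPartial_weakPartial h2).ae_eq hΩ h2

theorem BilipschitzOn.isBigO_weakPartial {n : ℕ} {Ω : Set (EuclideanSpace ℝ (Fin n))}
    {ξ : EuclideanSpace ℝ (Fin n) → EuclideanSpace ℝ (Fin n)} (hξ : BilipschitzOn Ω ξ)
    (hΩ : IsOpen Ω) (k s : Fin n) :
    weakPartial Ω k (fun y => ξ y s) =O[ae (volume.restrict Ω)] fun _ => (1 : ℝ) := by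
  obtain ⟨D, h1⟩ := hξ.exists_lipschitzOnWith_apply s
  refine isBigO_one_ae_of_abs_le (C := D) ?_
  filter_upwards [hξ.weakPartial_ae_eq hΩ k s, ae_restrict_mem hΩ.measurableSet] with x hx hxΩ
  rw [hx, partialDeriv, ← Real.norm_eq_abs]
  refine (ContinuousLinearMap.le_opNorm _ _).trans ?_
  simpa using norm_fderiv_le_of_lipschitzOn ℝ (hΩ.mem_nhds hxΩ) h1

theorem isBigO_one_locallyEssBoundedOn {n : ℕ} {Ω : Set (EuclideanSpace ℝ (Fin n))}
    {f : EuclideanSpace ℝ (Fin n) → ℝ}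
    (h : f =O[ae (volume.restrict Ω)] fun _ => (1 : ℝ)) : LocallyEssBoundedOn Ω f := by
  obtain ⟨C, hC⟩ := h.bound
  exact .of_ae_le (M := C) (by simpa using hC)

/-! ### The Hessian of `ξ` -/

/-- The weak derivative of the identity `(∇ξ)ᵀ G ∇ξ = G̃`. -/
theorem ae_partialDeriv_metric_eq {n : ℕ} {Ω : Set (EuclideanSpace ℝ (Fin n))}
    (hΩ : IsOpen Ω) {G Gt : EuclideanSpace ℝ (Fin n) → Matrix (Fin n) (Fin n) ℝ}
    (hG : IsMetricOn Ω G) (hGt : IsMetricOn Ω Gt)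
    {ξ : EuclideanSpace ℝ (Fin n) → EuclideanSpace ℝ (Fin n)} (hξ : BilipschitzOn Ω ξ)
    (hξW : MemSobolevVec Ω 2 2 ξ)
    (hiso : ∀ᵐ x ∂(volume.restrict Ω),
      (weakGradient Ω ξ x)ᵀ * G x * weakGradient Ω ξ x = Gt x) (k : Fin n) :
    ∀ᵐ x ∂volume.restrict Ω,
      (Matrix.of fun i j => partialDeriv k (fun y => Gt y i j) x) =
        (Matrix.of fun a i => weakPartial Ω k (weakPartial Ω i fun y => ξ y a) x)ᵀ * G x *
          weakGradient Ω ξ x +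
        (weakGradient Ω ξ x)ᵀ * (Matrix.of fun a b => partialDeriv k (fun y => G y a b) x) *
          weakGradient Ω ξ x +
        (weakGradient Ω ξ x)ᵀ * G x *
          (Matrix.of fun a i => weakPartial Ω k (weakPartial Ω i fun y => ξ y a) x) := by
  have key : ∀ i j, ∀ᵐ x ∂volume.restrict Ω, partialDeriv k (fun y => Gt y i j) x =
      ∑ b, ∑ a, ((weakPartial Ω k (weakPartial Ω i fun y => ξ y a) x * G x a b +
        weakPartial Ω i (fun y => ξ y a) x * partialDeriv k (fun y => G y a b) x) *
          weakPartial Ω j (fun y => ξ y b) x +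
        weakPartial Ω i (fun y => ξ y a) x * G x a b *
          weakPartial Ω k (weakPartial Ω j fun y => ξ y b) x) := by
    intro i j
    have hFb : ∀ a i, LocallyEssBoundedOn Ω (weakPartial Ω i fun y => ξ y a) := fun a i =>
      isBigO_one_locallyEssBoundedOn (hξ.isBigO_weakPartial hΩ i a)
    have hGb : ∀ a b, LocallyEssBoundedOn Ω fun x => G x a b := fun a b =>
      .of_continuousOn (hG.locLip a b).continuousOn
    have hF : ∀ a i, IsWeakPartial Ω k (weakPartial Ω i fun y => ξ y a)
        (weakPartial Ω k (weakPartial Ω i fun y => ξ y a)) := fun a i =>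
      ((hξW a).isWeakPartial_weakPartial hΩ k i).2
    -- The Leibniz rule twice on each product `F_ai G_ab F_bj`. Boundedness of `F` comes from the
    -- Lipschitz bound, weak differentiability of its entries from `W^{2,2}`.
    have h1 := IsWeakPartial.sum Finset.univ fun b _ => IsWeakPartial.sum Finset.univ fun a _ =>
      ((hF a i).mul hΩ ((hG.locLip a b).isWeakPartial hΩ k) (hFb a i) (hGb a b)).mul hΩ
        (hF b j) ((hFb a i).mul (hGb a b)) (hFb b j)
    refine ((hGt.locLip i j).isWeakPartial hΩ k).ae_eq hΩ (h1.congr hΩ ?_ Filter.EventuallyEq.rfl)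
    filter_upwards [hiso] with x hx
    rw [← hx, Matrix.mul_apply]
    refine Finset.sum_congr rfl fun b _ => ?_
    rw [Matrix.mul_apply, Finset.sum_mul]
    rfl
  have key' := ae_all_iff.2 fun i => ae_all_iff.2 fun j => key i j
  filter_upwards [key'] with x hx
  ext i j
  rw [Matrix.of_apply, hx]
  simp only [Matrix.add_apply, Matrix.mul_apply, Matrix.transpose_apply, Matrix.of_apply,
    weakGradient, Finset.sum_mul, ← Finset.sum_add_distrib]
  refine Finset.sum_congr rfl fun b _ => Finset.sum_congr rfl fun a _ => ?_
  ring

/-- The second weak derivatives of `ξ` in terms of the first derivatives of the metrics. -/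
theorem ae_hessian_eq {n : ℕ} {Ω : Set (EuclideanSpace ℝ (Fin n))}
    (hΩ : IsOpen Ω) {G Gt : EuclideanSpace ℝ (Fin n) → Matrix (Fin n) (Fin n) ℝ}
    (hG : IsMetricOn Ω G) (hGt : IsMetricOn Ω Gt)
    {ξ : EuclideanSpace ℝ (Fin n) → EuclideanSpace ℝ (Fin n)} (hξ : BilipschitzOn Ω ξ)
    (hξW : MemSobolevVec Ω 2 2 ξ)
    (hiso : ∀ᵐ x ∂(volume.restrict Ω),
      (weakGradient Ω ξ x)ᵀ * G x * weakGradient Ω ξ x = Gt x) :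
    ∀ᵐ x ∂volume.restrict Ω, ∀ i j,
      (fun s => weakPartial Ω i (weakPartial Ω j fun y => ξ y s) x) =
        (weakGradient Ω ξ x * (Gt x)⁻¹) *ᵥ fun k =>
          1 / 2 * (partialDeriv i (fun y => Gt y j k) x + partialDeriv j (fun y => Gt y i k) x -
            partialDeriv k (fun y => Gt y i j) x) -
          1 / 2 * (((weakGradient Ω ξ x)ᵀ *
              (Matrix.of fun a b => partialDeriv i (fun y => G y a b) x) *
              weakGradient Ω ξ x) j k +
            ((weakGradient Ω ξ x)ᵀ *
              (Matrix.of fun a b => partialDeriv j (fun y => G y a b) x) *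
              weakGradient Ω ξ x) i k -
            ((weakGradient Ω ξ x)ᵀ *
              (Matrix.of fun a b => partialDeriv k (fun y => G y a b) x) *
              weakGradient Ω ξ x) i j) := by
  have hsymm : ∀ᵐ x ∂volume.restrict Ω, ∀ k i a,
      weakPartial Ω k (weakPartial Ω i fun y => ξ y a) x =
        weakPartial Ω i (weakPartial Ω k fun y => ξ y a) x := by
    simp only [ae_all_iff]
    intro k i a
    have h1 := (hξW a).isWeakPartial_weakPartial hΩ k i
    have h2 := (hξW a).isWeakPartial_weakPartial hΩ i k
    exact h2.1.ae_eq_of_swap hΩ h1.1 h1.2 h2.2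
  have hd := ae_all_iff.2 fun k => ae_partialDeriv_metric_eq hΩ hG hGt hξ hξW hiso k
  obtain ⟨c, hc, hpos⟩ := hGt.unif_pos
  filter_upwards [hsymm, hd, hiso, ae_restrict_mem hΩ.measurableSet] with x h1 h2 h3 hxΩ
  exact hessian_eq_of_transpose_mul_mul (dGt := fun k => Matrix.of fun i j =>
      partialDeriv k (fun y => Gt y i j) x) (S := fun k => Matrix.of fun a i =>
      weakPartial Ω k (weakPartial Ω i fun y => ξ y a) x) h1 (hG.symm x hxΩ) h3
    (isUnit_det_of_coercive hc (hpos x hxΩ)) h2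

theorem IsMetricOn.isBigO_inv {n : ℕ} {Ω : Set (EuclideanSpace ℝ (Fin n))} (hΩ : IsOpen Ω)
    {G : EuclideanSpace ℝ (Fin n) → Matrix (Fin n) (Fin n) ℝ} (hG : IsMetricOn Ω G)
    (m k : Fin n) :
    (fun x => (G x)⁻¹ m k) =O[ae (volume.restrict Ω)] fun _ => (1 : ℝ) := by
  obtain ⟨c, hc, hpos⟩ := hG.unif_pos
  refine isBigO_one_ae_of_abs_le (C := 1 / c) ?_
  filter_upwards [ae_restrict_mem hΩ.measurableSet] with x hx
  exact abs_inv_apply_le_of_coercive hc (hpos x hx) m k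

theorem IsMetricOn.isBigO_partialDeriv {n : ℕ} {Ω : Set (EuclideanSpace ℝ (Fin n))}
    (hΩ : IsOpen Ω) {G : EuclideanSpace ℝ (Fin n) → Matrix (Fin n) (Fin n) ℝ}
    (hG : IsMetricOn Ω G) (i j k : Fin n) :
    (fun x => partialDeriv k (fun y => G y i j) x) =O[ae (volume.restrict Ω)]
      fun _ => (1 : ℝ) := by
  obtain ⟨C, hC⟩ := hG.deriv_bdd
  refine isBigO_one_ae_of_abs_le (C := C) ?_
  filter_upwards [ae_restrict_mem hΩ.measurableSet] with x hx
  exact hC x hx i j k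

/-- The formula for the Hessian involves no second derivatives of `ξ`: every factor on its
right-hand side is bounded by the Lipschitz constant or by the bounds on the metrics. -/
theorem isBigO_hessian {n : ℕ} {Ω : Set (EuclideanSpace ℝ (Fin n))}
    (hΩ : IsOpen Ω) {G Gt : EuclideanSpace ℝ (Fin n) → Matrix (Fin n) (Fin n) ℝ}
    (hG : IsMetricOn Ω G) (hGt : IsMetricOn Ω Gt)
    {ξ : EuclideanSpace ℝ (Fin n) → EuclideanSpace ℝ (Fin n)} (hξ : BilipschitzOn Ω ξ)
    (hξW : MemSobolevVec Ω 2 2 ξ)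
    (hiso : ∀ᵐ x ∂(volume.restrict Ω),
      (weakGradient Ω ξ x)ᵀ * G x * weakGradient Ω ξ x = Gt x) (i j s : Fin n) :
    weakPartial Ω i (weakPartial Ω j fun y => ξ y s) =O[ae (volume.restrict Ω)]
      fun _ => (1 : ℝ) := by
  have hF := fun s k => hξ.isBigO_weakPartial hΩ k s
  have hB : ∀ i j k, (fun x => ((weakGradient Ω ξ x)ᵀ *
      (Matrix.of fun a b => partialDeriv i (fun y => G y a b) x) *
      weakGradient Ω ξ x) j k) =O[ae (volume.restrict Ω)] fun _ => (1 : ℝ) := by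
    intro i j k
    simp only [Matrix.mul_apply, Matrix.transpose_apply, Matrix.of_apply, weakGradient]
    exact isBigO_one_sum fun b _ => isBigO_one_mul (isBigO_one_sum fun a _ =>
      isBigO_one_mul (hF a j) (hG.isBigO_partialDeriv hΩ a b i)) (hF b k)
  have h1 : weakPartial Ω i (weakPartial Ω j fun y => ξ y s) =ᵐ[volume.restrict Ω] _ :=
    (ae_hessian_eq hΩ hG hGt hξ hξW hiso).mono fun x hx => congrFun (hx i j) s
  refine h1.trans_isBigO ?_
  simp only [Matrix.mulVec, dotProduct]
  refine isBigO_one_sum fun k _ => isBigO_one_mul ?_ (((((hGt.isBigO_partialDeriv hΩ j k i).add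
    (hGt.isBigO_partialDeriv hΩ i k j)).sub
    (hGt.isBigO_partialDeriv hΩ i j k)).const_mul_left _).sub
    ((((hB i j k).add (hB j i k)).sub (hB k i j)).const_mul_left _))
  simp only [Matrix.mul_apply, Matrix.of_apply, weakGradient]
  exact isBigO_one_sum fun m _ => isBigO_one_mul (hF s m) (hGt.isBigO_inv hΩ m k)

/-! ### The transformation formula and the regularity of `ξ` -/

theorem mainTheorem8 (n : ℕ) (Ω U : Set (EuclideanSpace ℝ (Fin n)))
    (hΩ : IsOpen Ω) (hΩb : Bornology.IsBounded Ω)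
    (hU : IsOpen U) (hUb : Bornology.IsBounded U)
    (G Gt : EuclideanSpace ℝ (Fin n) → Matrix (Fin n) (Fin n) ℝ)
    (hG : IsMetricOn Ω G) (hGt : IsMetricOn Ω Gt)
    (ξ : EuclideanSpace ℝ (Fin n) → EuclideanSpace ℝ (Fin n))
    (hξU : ξ '' Ω = U) (hξ : BilipschitzOn Ω ξ)
    (hξW : MemSobolevVec Ω 2 2 ξ)
    (hiso : ∀ᵐ x ∂(volume.restrict Ω),
      (weakGradient Ω ξ x)ᵀ * G x * weakGradient Ω ξ x = Gt x) :
    (∀ i j s : Fin n, ∀ᵐ x ∂(volume.restrict Ω),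
      weakPartial Ω i (weakPartial Ω j fun y => ξ y s) x =
        ∑ m, weakPartial Ω m (fun y => ξ y s) x * christoffel Gt m i j x
        - ∑ p, ∑ q, weakPartial Ω i (fun y => ξ y p) x * weakPartial Ω j (fun y => ξ y q) x *
            christoffel (transportedMetric Ω ξ G) s p q (ξ x)) ∧
    MemSobolevVec Ω 2 ∞ ξ := by
  subst hξU
  refine ⟨fun i j s => ?_, fun s => ?_⟩
  · have hchain : ∀ᵐ x ∂volume.restrict Ω, ∀ k a b, partialDeriv k (fun y => G y a b) x =
        ∑ p, partialDeriv p (fun u => transportedMetric Ω ξ G u a b) (ξ x) *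
          weakPartial Ω k (fun y => ξ y p) x := by
      have h1 := ae_all_iff.2 fun k => ae_all_iff.2 fun a => ae_all_iff.2 fun b =>
        hξ.ae_partialDeriv_eq hΩ hU (hG.locLip a b) k
      have h2 := ae_all_iff.2 fun k => ae_all_iff.2 fun p => hξ.weakPartial_ae_eq hΩ k p
      filter_upwards [h1, h2] with x h1 h2 k a b
      simp only [h1, h2, transportedMetric]
    have hHsymm : ∀ u ∈ ξ '' Ω, (transportedMetric Ω ξ G u).IsSymm := by
      rintro _ ⟨x, hx, rfl⟩
      rw [transportedMetric, hξ.injOn.leftInvOn_invFunOn hx]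
      exact hG.symm x hx
    obtain ⟨c, hc, hpos⟩ := hGt.unif_pos
    filter_upwards [ae_hessian_eq hΩ hG hGt hξ hξW hiso, hchain, hiso,
      ae_restrict_mem hΩ.measurableSet] with x h1 h2 h3 hxΩ
    have hH : transportedMetric Ω ξ G (ξ x) = G x := by
      rw [transportedMetric, hξ.injOn.leftInvOn_invFunOn hxΩ]
    have hdet := isUnit_det_of_coercive hc (hpos x hxΩ)
    have h4 := transpose_mul_mul_koszul (F := weakGradient Ω ξ x)
      (dG := fun k => Matrix.of fun a b => partialDeriv k (fun y => G y a b) x)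
      (dH := fun k => Matrix.of fun a b =>
        partialDeriv k (fun u => transportedMetric Ω ξ G u a b) (ξ x))
      (fun k => Matrix.IsSymm.ext fun a b =>
        partialDeriv_isSymm hU hHsymm (mem_image_of_mem ξ hxΩ) k b a) h2 i j
    have h5 := congrFun (h1 i j) s
    -- Separates the contribution of `G̃`, which yields `Γ̃`, from that of `G`, which `h4` rewrites
    -- through derivatives of `G ∘ ξ⁻¹`.
    have h6 : ∀ u v : Fin n → ℝ, (fun k => 1 / 2 * u k - 1 / 2 * v k) =
        (fun k => 1 / 2 * u k) - (1 / 2 : ℝ) • v := fun u v => rfl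
    rw [h6, h4, Matrix.mulVec_sub, Matrix.mulVec_smul, Matrix.mulVec_mulVec,
      mul_inv_mul_transpose_eq_inv h3 hdet, ← Matrix.mulVec_mulVec] at h5
    refine h5.trans ?_
    rw [Pi.sub_apply, Pi.smul_apply]
    congr 1
    · simp only [Matrix.mulVec, dotProduct, christoffel, Finset.mul_sum, weakGradient,
        Matrix.of_apply]
      refine Finset.sum_congr rfl fun m _ => Finset.sum_congr rfl fun k _ => ?_
      -- The Koszul combination and `christoffel` list the two metric indices in opposite order.
      rw [partialDeriv_isSymm hΩ hGt.symm hxΩ i j k, partialDeriv_isSymm hΩ hGt.symm hxΩ j i k]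
      ring
    · simp only [Matrix.mulVec, dotProduct, christoffel, hH, Finset.mul_sum, smul_eq_mul]
      rw [Finset.sum_comm]
      refine Finset.sum_congr rfl fun p _ => ?_
      rw [Finset.sum_comm]
      refine Finset.sum_congr rfl fun q _ => Finset.sum_congr rfl fun m _ => ?_
      simp only [weakGradient, Matrix.of_apply]
      ring
  · obtain ⟨D, hD⟩ := hξ.exists_lipschitzOnWith
    obtain ⟨C, hC⟩ := hUb.exists_norm_le
    have hmeas : AEStronglyMeasurable (fun x => ξ x s) (volume.restrict Ω) :=
      ((EuclideanSpace.proj s : EuclideanSpace ℝ (Fin n) →L[ℝ] ℝ).continuous.comp_continuousOn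
        hD.continuousOn).aestronglyMeasurable hΩ.measurableSet
    refine ⟨memLp_top_of_bound hmeas C ?_, fun j => ⟨_,
      ((hξW s).isWeakPartial_weakPartial hΩ j j).1,
      memLp_top_of_isBigO_one ((hξW s).isWeakPartial_weakPartial hΩ j j).1.2.1.aestronglyMeasurable
        (hξ.isBigO_weakPartial hΩ j s), fun i => ⟨_,
      ((hξW s).isWeakPartial_weakPartial hΩ i j).2,
      memLp_top_of_isBigO_one ((hξW s).isWeakPartial_weakPartial hΩ i j).2.2.1.aestronglyMeasurable
        (isBigO_hessian hΩ hG hGt hξ hξW hiso i j s)⟩⟩⟩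
    filter_upwards [ae_restrict_mem hΩ.measurableSet] with x hx
    exact (PiLp.norm_apply_le (ξ x) s).trans (hC _ (mem_image_of_mem ξ hx))
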